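/- Let $M$ be a smooth $n$-dimensional manifold, with tangent bundle $\pi:TM\to M$. A chart $(x^i)$ of $M$ induces coordinates $(x^i,y^i)$ on $TM$, the pair $(x,y)$ standing for the tangent vector $\sum_i y^i\partial_{x^i}$. Let $M^\star\subset TM\setminus\{0\}$ be open and positively conical ($y\in M^\star$ and $\lambda>0$ imply $\lambda y\in M^\star$), and let $L:M^\star\to(0,\infty)$ be a Finsler metric: $L$ is smooth, $L(x,\lambda y)=\lambda L(x,y)$ for all $\lambda>0$, and, with $F=\tfrac12L^2$, the matrix $g_{ij}=\dfrac{\partial^2F}{\partial y^i\partial y^j}$ is invertible at every point of $M^\star$, in every chart. (If each $L(x,\cdot)$ is a Minkowski norm, then $M^\star=TM\setminus\{0\}$.) With summation over repeated indices put $$G_j=\tfrac12\Big(\frac{\partial^2F}{\partial y^j\partial x^i}\,y^i-\frac{\partial F}{\partial x^j}\Big),\qquad G^i=g^{ij}G_j,\qquad (g^{ij})=(g_{ij})^{-1},$$ $$\eta=-g_{ij}\,y^i\,dx^j,\qquad \mathbb G=y^i\frac{\partial}{\partial x^i}-2G^i\frac{\partial}{\partial y^i}.$$ Then the Hilbert $1$-form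 $\eta$ and the geodesic spray $\mathbb G$ do not depend on the chart, so that they are defined on all of $M^\star$; $d\eta$ is a symplectic form on $M^\star$ (smooth, closed and non-degenerate); and $$d\eta(\mathbb G,\cdot)=d\big(\tfrac12L^2\big)\quad\text{on } M^\star .$$ So, writing $X_h$ for the Hamiltonian vector field of a function $h$, that is, the smooth vector field on $M^\star$ with $d\eta(X_h,\cdot)=dh$, one has $X_{\frac12L^2}=\mathbb G$ and $X_L=\mathbb G/L$. -/

import Mathlib

open scoped Manifold ContDiff Topology

noncomputable section

namespace Finsler

/-! ### Differential forms on manifolds -/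

section Forms

variable {E : Type*} [NormedAddCommGroup E] [NormedSpace ℝ E]
  {H : Type*} [TopologicalSpace H] (I : ModelWithCorners ℝ E H)
  {N : Type*} [TopologicalSpace N] [ChartedSpace H N] [IsManifold I 1 N] {k : ℕ}

/-- The expression of a differential `k`-form `α` on a manifold `N` in the preferred chart at `p`:
the pullback of `α` under the inverse of that chart. -/
def formInChart (α : ∀ q : N, TangentSpace I q [⋀^Fin k]→L[ℝ] ℝ) (p : N) :
    E → E [⋀^Fin k]→L[ℝ] ℝ := fun z =>
  (α ((extChartAt I p).symm z)).compContinuousLinearMap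
    (mfderivWithin 𝓘(ℝ, E) I (extChartAt I p).symm (Set.range I) z)

/-- The exterior derivative of a differential `k`-form on a manifold, computed at the point `p` in
the preferred chart at `p`. -/
def extDerivForm (α : ∀ q : N, TangentSpace I q [⋀^Fin k]→L[ℝ] ℝ) (p : N) :
    TangentSpace I p [⋀^Fin (k + 1)]→L[ℝ] ℝ :=
  (extDerivWithin (formInChart I α p) (Set.range I) (extChartAt I p p)).compContinuousLinearMap
    (mfderiv I 𝓘(ℝ, E) (extChartAt I p) p)

/-- Smoothness of a differential form at the points of `U`. -/
def IsSmoothFormOn (α : ∀ q : N, TangentSpace I q [⋀^Fin k]→L[ℝ] ℝ) (U : Set N) : Prop :=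
  ∀ p ∈ U, ContDiffWithinAt ℝ ∞ (formInChart I α p) (Set.range I) (extChartAt I p p)

/-- `α` is a symplectic form on `U`: smooth, closed and pointwise non-degenerate. -/
structure IsSymplecticOn (α : ∀ q : N, TangentSpace I q [⋀^Fin 2]→L[ℝ] ℝ) (U : Set N) : Prop where
  smooth : IsSmoothFormOn I α U
  closed : ∀ p ∈ U, extDerivForm I α p = 0
  nondegenerate : ∀ p ∈ U, ∀ v : TangentSpace I p, (∀ w, α p ![v, w] = 0) → v = 0

/-- `X` is a smooth vector field on `U` with `α(X, ·) = dh` there. If `α` is non-degenerate, this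
determines `X` on `U`. -/
structure IsHamiltonianVectorFieldOn (α : ∀ q : N, TangentSpace I q [⋀^Fin 2]→L[ℝ] ℝ) (U : Set N)
    (h : N → ℝ) (X : ∀ q : N, TangentSpace I q) : Prop where
  smooth : ContMDiffOn I I.tangent ∞ (fun q => (⟨q, X q⟩ : TangentBundle I N)) U
  contraction : ∀ p ∈ U, ∀ w : TangentSpace I p,
    α p ![X p, w] = mvfderiv I h p w

end Forms

/-! ### Coordinates on the tangent bundle and the local objects of Finsler geometry

A chart `φ` of `M` with coordinates `xⁱ` gives the coordinates `(xⁱ, yⁱ)` of the tangent vector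
`∑ yⁱ ∂/∂xⁱ`. -/

/-- The model space `ℝⁿ`. -/
abbrev Model (n : ℕ) : Type := EuclideanSpace ℝ (Fin n)

/-- The `i`-th vector of the standard basis of `ℝⁿ`. -/
def stdVec {n : ℕ} (i : Fin n) : Model n := EuclideanSpace.single i 1

/-- `∂f/∂xⁱ` for a function `f` of `(x, y)`. -/
def partialX {n : ℕ} (i : Fin n) (f : Model n × Model n → ℝ) : Model n × Model n → ℝ :=
  fun z => fderiv ℝ f z (stdVec i, 0)

/-- `∂f/∂yⁱ` for a function `f` of `(x, y)`. -/
def partialY {n : ℕ} (i : Fin n) (f : Model n × Model n → ℝ) : Model n × Model n → ℝ :=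
  fun z => fderiv ℝ f z (0, stdVec i)

section Coordinates

variable {n : ℕ} {M : Type*} [TopologicalSpace M] [ChartedSpace (Model n) M]
  [IsManifold (𝓡 n) ∞ M]

/-- The tangent vector `∑ yⁱ ∂/∂xⁱ` at the point with coordinates `x` in the chart `φ`. -/
def vectorOfCoords (φ : OpenPartialHomeomorph M (Model n)) (z : Model n × Model n) :
    TangentBundle (𝓡 n) M :=
  ⟨φ.symm z.1, mfderiv (𝓡 n) (𝓡 n) φ.symm z.1 z.2⟩

/-- The coordinates `(x, y)` of a tangent vector in the chart `φ`. -/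
def coordsOfVector (φ : OpenPartialHomeomorph M (Model n)) (p : TangentBundle (𝓡 n) M) :
    Model n × Model n :=
  (φ p.1, mfderiv (𝓡 n) (𝓡 n) φ p.1 p.2)

/-- `F = L² / 2` as a function on the tangent bundle. -/
def energy (L : TangentBundle (𝓡 n) M → ℝ) : TangentBundle (𝓡 n) M → ℝ :=
  fun p => 1 / 2 * L p ^ 2

/-- `F = L² / 2` as a function of the coordinates `(x, y)`. -/
def localEnergy (L : TangentBundle (𝓡 n) M → ℝ) (φ : OpenPartialHomeomorph M (Model n)) :
    Model n × Model n → ℝ :=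
  fun z => energy L (vectorOfCoords φ z)

/-- The matrix `g_{ij} = ∂²F/∂yⁱ∂yʲ`. -/
def metricMatrix (L : TangentBundle (𝓡 n) M → ℝ) (φ : OpenPartialHomeomorph M (Model n))
    (z : Model n × Model n) : Matrix (Fin n) (Fin n) ℝ :=
  Matrix.of fun i j => partialY i (partialY j (localEnergy L φ)) z

/-- `G_j`, where `2 G_j = ∑ᵢ yⁱ ∂²F/∂yʲ∂xⁱ - ∂F/∂xʲ`. -/
def sprayCovector (L : TangentBundle (𝓡 n) M → ℝ) (φ : OpenPartialHomeomorph M (Model n))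
    (z : Model n × Model n) (j : Fin n) : ℝ :=
  1 / 2 * (∑ i, partialY j (partialX i (localEnergy L φ)) z * z.2 i -
    partialX j (localEnergy L φ) z)

/-- The spray coefficients `Gⁱ = ∑ⱼ gⁱʲ G_j`, where `(gⁱʲ)` is the inverse matrix of `(g_{ij})`. -/
def sprayCoeff (L : TangentBundle (𝓡 n) M → ℝ) (φ : OpenPartialHomeomorph M (Model n))
    (z : Model n × Model n) (i : Fin n) : ℝ :=
  ∑ j, (metricMatrix L φ z)⁻¹ i j * sprayCovector L φ z j

/-- The tangent vector `∂/∂xⁱ` of `TM` at `p`, in the coordinates `(x, y)` induced by `φ`. -/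
def coordVecX (φ : OpenPartialHomeomorph M (Model n)) (i : Fin n) (p : TangentBundle (𝓡 n) M) :
    TangentSpace (𝓡 n).tangent p :=
  mfderiv 𝓘(ℝ, Model n × Model n) (𝓡 n).tangent (vectorOfCoords φ) (coordsOfVector φ p)
    (stdVec i, (0 : Model n))

/-- The tangent vector `∂/∂yⁱ` of `TM` at `p`, in the coordinates `(x, y)` induced by `φ`. -/
def coordVecY (φ : OpenPartialHomeomorph M (Model n)) (i : Fin n) (p : TangentBundle (𝓡 n) M) :
    TangentSpace (𝓡 n).tangent p :=
  mfderiv 𝓘(ℝ, Model n × Model n) (𝓡 n).tangent (vectorOfCoords φ) (coordsOfVector φ p)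
    ((0 : Model n), stdVec i)

/-- The covector `dxⁱ` of `TM` at `p`: the differential of the function `q ↦ xⁱ(q)`. -/
def coordCovecX (φ : OpenPartialHomeomorph M (Model n)) (i : Fin n) (p : TangentBundle (𝓡 n) M) :
    TangentSpace (𝓡 n).tangent p →L[ℝ] ℝ :=
  mvfderiv (𝓡 n).tangent (fun q : TangentBundle (𝓡 n) M => φ q.1 i) p

/-- The covector `- ∑ g_{ij} yⁱ dxʲ` at `p`, in the coordinates induced by `φ`. -/
def hilbertFormIn (L : TangentBundle (𝓡 n) M → ℝ) (φ : OpenPartialHomeomorph M (Model n))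
    (p : TangentBundle (𝓡 n) M) : TangentSpace (𝓡 n).tangent p →L[ℝ] ℝ :=
  -∑ i, ∑ j, (metricMatrix L φ (coordsOfVector φ p) i j * (coordsOfVector φ p).2 i) •
    coordCovecX φ j p

/-- The vector `∑ yⁱ ∂/∂xⁱ - 2 ∑ Gⁱ ∂/∂yⁱ` at `p`, in the coordinates induced by `φ`. -/
def geodesicSprayIn (L : TangentBundle (𝓡 n) M → ℝ) (φ : OpenPartialHomeomorph M (Model n))
    (p : TangentBundle (𝓡 n) M) : TangentSpace (𝓡 n).tangent p :=
  ∑ i, (coordsOfVector φ p).2 i • coordVecX φ i p -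
    ∑ i, (2 * sprayCoeff L φ (coordsOfVector φ p) i) • coordVecY φ i p

end Coordinates

/-! ### Finsler spaces -/

/-- A Finsler metric `L` on the smooth manifold `M`, defined on an open, positively conical set
`domain` of non-zero tangent vectors (all of them, for a metric given by a Minkowski norm on each
tangent space). -/
structure FinslerMetric (n : ℕ) (M : Type*) [TopologicalSpace M] [ChartedSpace (Model n) M]
    [IsManifold (𝓡 n) ∞ M] where
  domain : Set (TangentBundle (𝓡 n) M)
  L : TangentBundle (𝓡 n) M → ℝ
  isOpen_domain : IsOpen domain
  ne_zero : ∀ (x : M) (y : TangentSpace (𝓡 n) x),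
    (⟨x, y⟩ : TangentBundle (𝓡 n) M) ∈ domain → y ≠ 0
  conical : ∀ (x : M) (y : TangentSpace (𝓡 n) x) (c : ℝ), 0 < c →
    (⟨x, y⟩ : TangentBundle (𝓡 n) M) ∈ domain → (⟨x, c • y⟩ : TangentBundle (𝓡 n) M) ∈ domain
  smooth : ContMDiffOn (𝓡 n).tangent 𝓘(ℝ, ℝ) ∞ L domain
  pos : ∀ p ∈ domain, 0 < L p
  homogeneous : ∀ (x : M) (y : TangentSpace (𝓡 n) x) (c : ℝ), 0 < c →
    (⟨x, y⟩ : TangentBundle (𝓡 n) M) ∈ domain →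
      L (⟨x, c • y⟩ : TangentBundle (𝓡 n) M) = c * L (⟨x, y⟩ : TangentBundle (𝓡 n) M)
  regular : ∀ φ ∈ IsManifold.maximalAtlas (𝓡 n) ∞ M, ∀ p ∈ domain, p.1 ∈ φ.source →
    (metricMatrix L φ (coordsOfVector φ p)).det ≠ 0

namespace FinslerMetric

variable {n : ℕ} {M : Type*} [TopologicalSpace M] [ChartedSpace (Model n) M]
  [IsManifold (𝓡 n) ∞ M] (𝓕 : FinslerMetric n M)

/-- The Hilbert form `η`, given at `p` by its expression in the preferred chart of `M` at the base
point of `p`. -/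
def hilbertForm (p : TangentBundle (𝓡 n) M) : TangentSpace (𝓡 n).tangent p →L[ℝ] ℝ :=
  hilbertFormIn 𝓕.L (chartAt (Model n) p.1) p

/-- The exterior derivative `dη` of the Hilbert form. -/
def dHilbertForm (p : TangentBundle (𝓡 n) M) : TangentSpace (𝓡 n).tangent p [⋀^Fin 2]→L[ℝ] ℝ :=
  extDerivForm (𝓡 n).tangent
    (fun q => ContinuousAlternatingMap.ofSubsingleton ℝ (TangentSpace (𝓡 n).tangent q) ℝ (0 : Fin 1)
      (𝓕.hilbertForm q)) p

/-- The geodesic spray, given at `p` by its expression in the preferred chart of `M` at the base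
point of `p`. -/
def geodesicSpray (p : TangentBundle (𝓡 n) M) : TangentSpace (𝓡 n).tangent p :=
  geodesicSprayIn 𝓕.L (chartAt (Model n) p.1) p

end FinslerMetric

end Finsler

end

noncomputable section

/-! Write `F = L²/2`, a function homogeneous of degree 2 in `y`. Differentiating Euler's identity
`F_{yⁱ} yⁱ = 2F` along `y` gives `g_{ij} yⁱ = F_{yʲ}`, so `η = -F_{yʲ} dxʲ`. Hence `η(w)` is minus
the derivative of `F` at `p` along the fibre in the direction `dπ(w)`, which mentions no chart
(`hilbertFormIn_apply`).

In coordinates, `dη(v, w) = D²F(w, (0, v₁)) - D²F(v, (0, w₁))`. Its blocks make it non-degenerate as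
soon as `g` is invertible (`eq_zero_of_extDeriv_localHilbertForm`). For `v = (y, -2G)` the
differentiated Euler identity and `g_{ij} Gⁱ = G_j` reduce the right side to `dF(w)`
(`extDeriv_localSpray`).

The coordinate expression of the spray thus solves `dη(X, ·) = dF` in every chart; by non-degeneracy
the solutions coincide, so the spray is intrinsic without any transformation law for `Gⁱ`. The field
of `L` follows from `dF = L dL`.

The forms and `d` are defined pointwise, each point using its own preferred chart.
`pullbackForm_extDerivForm` carries the computation over to any fixed chart. -/

namespace Finsler

open Set Filter

/-! ### Pullback of forms and its compatibility with `d`. -/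

section Pullback

variable {E : Type*} [NormedAddCommGroup E] [NormedSpace ℝ E]
  {H : Type*} [TopologicalSpace H] (I : ModelWithCorners ℝ E H)
  {N : Type*} [TopologicalSpace N] [ChartedSpace H N] {k : ℕ}
  {E' : Type*} [NormedAddCommGroup E'] [NormedSpace ℝ E']

/-- The pullback of a differential form on a manifold under a map from a normed space. -/
def pullbackForm (α : ∀ q : N, TangentSpace I q [⋀^Fin k]→L[ℝ] ℝ) (Ψ : E' → N) :
    E' → E' [⋀^Fin k]→L[ℝ] ℝ := fun z =>
  (α (Ψ z)).compContinuousLinearMap (mfderiv 𝓘(ℝ, E') I Ψ z)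

variable {I}

/-- Every tangent space is definitionally the model `E`. Taking `A` and `A'` as maps into `E` allows
both equalities to be substituted although the type of `α q` depends on `q`. -/
theorem compContinuousLinearMap_congr (α : ∀ q : N, TangentSpace I q [⋀^Fin k]→L[ℝ] ℝ)
    {q q' : N} {A A' : E' →L[ℝ] E} (hq : q = q') (hA : A = A') :
    ((α q).compContinuousLinearMap A : E' [⋀^Fin k]→L[ℝ] ℝ) =
      (α q').compContinuousLinearMap A' := by
  subst hq hA
  rfl

theorem pullbackForm_eventuallyEq {α : ∀ q : N, TangentSpace I q [⋀^Fin k]→L[ℝ] ℝ}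
    {Ψ Ψ' : E' → N} {z : E'} (h : Ψ =ᶠ[𝓝 z] Ψ') :
    pullbackForm I α Ψ =ᶠ[𝓝 z] pullbackForm I α Ψ' := by
  filter_upwards [eventually_eventually_nhds.2 h] with y hy
  have h1 : Ψ y = Ψ' y := hy.self_of_nhds
  have h2 : mfderiv 𝓘(ℝ, E') I Ψ y = mfderiv 𝓘(ℝ, E') I Ψ' y := Filter.EventuallyEq.mfderiv_eq hy
  exact compContinuousLinearMap_congr α h1 h2

theorem formInChart_eq_pullbackForm [I.Boundaryless]
    (α : ∀ q : N, TangentSpace I q [⋀^Fin k]→L[ℝ] ℝ) (p : N) :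
    formInChart I α p = pullbackForm I α (extChartAt I p).symm := by
  funext z
  simp [formInChart, pullbackForm, I.range_eq_univ, mfderivWithin_univ]

variable [IsManifold I 1 N]

/-- Near `z`, the pullback under `Ψ` is the pullback of the expression in the preferred chart. -/
theorem pullbackForm_eventuallyEq_formInChart [I.Boundaryless]
    (α : ∀ q : N, TangentSpace I q [⋀^Fin k]→L[ℝ] ℝ) {Ψ : E' → N} {z : E'}
    (hΨ : ContMDiffAt 𝓘(ℝ, E') I 1 Ψ z) :
    pullbackForm I α Ψ =ᶠ[𝓝 z] fun y =>
      (formInChart I α (Ψ z) ((extChartAt I (Ψ z) ∘ Ψ) y)).compContinuousLinearMap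
        (fderiv ℝ (extChartAt I (Ψ z) ∘ Ψ) y) := by
  have hsrc : ∀ᶠ y in 𝓝 z, Ψ y ∈ (extChartAt I (Ψ z)).source :=
    hΨ.continuousAt.eventually (extChartAt_source_mem_nhds (I := I) (Ψ z))
  have hd : ∀ᶠ y in 𝓝 z, ContMDiffAt 𝓘(ℝ, E') I 1 Ψ y :=
    contMDiffAt_iff_contMDiffAt_nhds (by simp) |>.1 hΨ
  filter_upwards [eventually_eventually_nhds.2 hsrc, hd] with y hy hdy
  have hy0 := hy.self_of_nhds
  have hyd : MDifferentiableAt 𝓘(ℝ, E') I Ψ y := hdy.mdifferentiableAt one_ne_zero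
  have hτ : MDifferentiableAt I 𝓘(ℝ, E) (extChartAt I (Ψ z)) (Ψ y) :=
    mdifferentiableAt_extChartAt (by simpa using hy0)
  have hσ : MDifferentiableAt 𝓘(ℝ, E) I (extChartAt I (Ψ z)).symm
      ((extChartAt I (Ψ z) ∘ Ψ) y) := by
    have := mdifferentiableWithinAt_extChartAt_symm ((extChartAt I (Ψ z)).map_source hy0)
    rwa [I.range_eq_univ, mdifferentiableWithinAt_univ] at this
  have hcomp : (extChartAt I (Ψ z)).symm ∘ (extChartAt I (Ψ z) ∘ Ψ) =ᶠ[𝓝 y] Ψ := by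
    filter_upwards [hy] with x hx
    exact (extChartAt I (Ψ z)).left_inv hx
  let A : E →L[ℝ] E :=
    mfderiv 𝓘(ℝ, E) I (extChartAt I (Ψ z)).symm ((extChartAt I (Ψ z) ∘ Ψ) y)
  let B : E' →L[ℝ] E := fderiv ℝ (extChartAt I (Ψ z) ∘ Ψ) y
  have hB : mfderiv 𝓘(ℝ, E') 𝓘(ℝ, E) (extChartAt I (Ψ z) ∘ Ψ) y = B := mfderiv_eq_fderiv
  have h1 : mfderiv 𝓘(ℝ, E') I Ψ y = A.comp B :=
    (Filter.EventuallyEq.mfderiv_eq hcomp).symm.trans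
      ((mfderiv_comp y hσ (hτ.comp y hyd)).trans (congrArg (fun T => A.comp T) hB))
  rw [formInChart_eq_pullbackForm]
  exact compContinuousLinearMap_congr (E' := E') (A := mfderiv 𝓘(ℝ, E') I Ψ y) (A' := A.comp B)
    α hcomp.self_of_nhds.symm h1

/-- The exterior derivative on a manifold commutes with pullback. -/
theorem pullbackForm_extDerivForm [I.Boundaryless] [IsManifold I ∞ N]
    (α : ∀ q : N, TangentSpace I q [⋀^Fin k]→L[ℝ] ℝ) {Ψ : E' → N} {z : E'}
    (hΨ : ContMDiffAt 𝓘(ℝ, E') I ∞ Ψ z)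
    (hα : DifferentiableAt ℝ (formInChart I α (Ψ z)) (extChartAt I (Ψ z) (Ψ z))) :
    pullbackForm I (extDerivForm I α) Ψ z = extDeriv (pullbackForm I α Ψ) z := by
  have hτ : ContMDiffAt I 𝓘(ℝ, E) ∞ (extChartAt I (Ψ z)) (Ψ z) := contMDiffAt_extChartAt
  have hτΨ : ContDiffAt ℝ ∞ (extChartAt I (Ψ z) ∘ Ψ) z := (hτ.comp z hΨ).contDiffAt
  -- Near `z` the pullback factors through the chart expression of `Ψ`, a map of normed spaces,
  -- where `d` commutes with pullback. That rule needs second derivatives to be symmetric, whence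
  -- the smoothness side goal.
  rw [(pullbackForm_eventuallyEq_formInChart α
    (hΨ.of_le (by exact_mod_cast le_top))).extDeriv_eq,
    extDeriv_pullback (r := ∞) (f := extChartAt I (Ψ z) ∘ Ψ) hα hτΨ
      (by simpa using ENat.LEInfty.out)]
  have h1 : fderiv ℝ (extChartAt I (Ψ z) ∘ Ψ) z =
      (mfderiv I 𝓘(ℝ, E) (extChartAt I (Ψ z)) (Ψ z)).comp (mfderiv 𝓘(ℝ, E') I Ψ z) := by
    rw [← mfderiv_eq_fderiv]
    exact mfderiv_comp z (hτ.mdifferentiableAt (by simp)) (hΨ.mdifferentiableAt (by simp))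
  rw [h1]
  unfold pullbackForm extDerivForm
  rw [I.range_eq_univ, extDerivWithin_univ]
  rfl

end Pullback

/-- The exterior derivative of a smooth form is smooth. -/
theorem contDiffAt_extDeriv {E : Type*} [NormedAddCommGroup E] [NormedSpace ℝ E] {k : ℕ}
    {α : E → E [⋀^Fin k]→L[ℝ] ℝ} {z : E} (h : ContDiffAt ℝ ∞ α z) :
    ContDiffAt ℝ ∞ (extDeriv α) z :=
  ((ContinuousAlternatingMap.alternatizeUncurryFinCLM ℝ E ℝ (n := k)).contDiff.contDiffAt.comp z
    (h.fderiv_right (m := ∞) (by simp))).congr_of_eventuallyEq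
    (Eventually.of_forall fun _ => by simp [extDeriv])

/-! ### Smoothness of `dα` and `d² = 0` on a manifold. -/

section Manifold

variable {E : Type*} [NormedAddCommGroup E] [NormedSpace ℝ E]
  {H : Type*} [TopologicalSpace H] {I : ModelWithCorners ℝ E H}
  {N : Type*} [TopologicalSpace N] [ChartedSpace H N] [IsManifold I 1 N] [IsManifold I ∞ N]
  [I.Boundaryless] {k : ℕ} {α : ∀ q : N, TangentSpace I q [⋀^Fin k]→L[ℝ] ℝ} {U : Set N}

/-- At a nearby point `q`, `extDerivForm` is computed in the chart at `q`, not at `p`. Naturality of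
`d` under the inverse chart at `p` removes the discrepancy, so that `dα` can be differentiated again
in one chart. -/
theorem formInChart_extDerivForm (hU : IsOpen U) (hα : IsSmoothFormOn I α U) {p : N}
    (hp : p ∈ U) :
    formInChart I (extDerivForm I α) p =ᶠ[𝓝 (extChartAt I p p)]
      extDeriv (formInChart I α p) := by
  have hc : ContinuousAt (extChartAt I p).symm (extChartAt I p p) := continuousAt_extChartAt_symm p
  have hmem : ∀ᶠ z in 𝓝 (extChartAt I p p), (extChartAt I p).symm z ∈ U :=
    hc.eventually (hU.mem_nhds (by simpa using hp))
  filter_upwards [hmem, extChartAt_target_mem_nhds (I := I) p] with z hz hzt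
  have hΨ : ContMDiffAt 𝓘(ℝ, E) I ∞ (extChartAt I p).symm z := by
    have := contMDiffWithinAt_extChartAt_symm_range (I := I) (n := ∞) p hzt
    rwa [I.range_eq_univ, contMDiffWithinAt_univ] at this
  have hd := hα _ hz
  rw [I.range_eq_univ, contDiffWithinAt_univ] at hd
  rw [formInChart_eq_pullbackForm, formInChart_eq_pullbackForm]
  exact pullbackForm_extDerivForm α hΨ (hd.differentiableAt (by simp))

theorem IsSmoothFormOn.extDerivForm (hU : IsOpen U) (hα : IsSmoothFormOn I α U) :
    IsSmoothFormOn I (extDerivForm I α) U := by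
  intro p hp
  have hd := hα _ hp
  rw [I.range_eq_univ, contDiffWithinAt_univ] at hd ⊢
  exact (contDiffAt_extDeriv hd).congr_of_eventuallyEq (formInChart_extDerivForm hU hα hp)

theorem extDerivForm_extDerivForm (hU : IsOpen U) (hα : IsSmoothFormOn I α U) {p : N}
    (hp : p ∈ U) : Finsler.extDerivForm I (Finsler.extDerivForm I α) p = 0 := by
  have hd := hα _ hp
  rw [I.range_eq_univ, contDiffWithinAt_univ] at hd
  rw [Finsler.extDerivForm, I.range_eq_univ, extDerivWithin_univ,
    (formInChart_extDerivForm hU hα hp).extDeriv_eq,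
    extDeriv_extDeriv_apply (r := ∞) hd (by simpa using ENat.LEInfty.out)]
  rfl

end Manifold

open scoped Matrix

/-! ### The Hilbert form of a function on `ℝⁿ × ℝⁿ`. -/

section Local

variable {n : ℕ} {f : Model n × Model n → ℝ} {z : Model n × Model n}

theorem sum_smul_stdVec (v : Model n) : ∑ i, v i • stdVec i = v := by
  ext j
  simp [stdVec, Pi.single_apply]

theorem sum_smul_stdVec_prod (v w : Model n) :
    ((v, w) : Model n × Model n) =
      ∑ i, v i • (stdVec i, (0 : Model n)) + ∑ i, w i • ((0 : Model n), stdVec i) := by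
  apply Prod.ext
  · simp [Prod.fst_sum, sum_smul_stdVec]
  · simp [Prod.snd_sum, sum_smul_stdVec]

theorem differentiableAt_fderiv (hf : ContDiffAt ℝ ∞ f z) :
    DifferentiableAt ℝ (fderiv ℝ f) z :=
  (hf.fderiv_right (m := ∞) (by simp)).differentiableAt (by simp)

theorem fderiv_fderiv_apply (hf : ContDiffAt ℝ ∞ f z) (v w : Model n × Model n) :
    fderiv ℝ (fun y => fderiv ℝ f y w) z v = fderiv ℝ (fderiv ℝ f) z v w := by
  rw [fderiv_clm_apply (differentiableAt_fderiv hf) (differentiableAt_const w)]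
  simp

theorem fderiv_fderiv_symm (hf : ContDiffAt ℝ ∞ f z) (v w : Model n × Model n) :
    fderiv ℝ (fderiv ℝ f) z v w = fderiv ℝ (fderiv ℝ f) z w v :=
  (hf.isSymmSndFDerivAt (by simpa using ENat.LEInfty.out)) v w

/-- The derivative of Euler's identity `∂F/∂yⁱ yⁱ = 2 F`. -/
theorem fderiv_fderiv_radial (hf : ContDiffAt ℝ ∞ f z)
    (he : ∀ᶠ y in 𝓝 z, fderiv ℝ f y (0, y.2) = 2 * f y) (w : Model n × Model n) :
    fderiv ℝ (fderiv ℝ f) z w (0, z.2) = 2 * fderiv ℝ f z w - fderiv ℝ f z (0, w.2) := by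
  -- `R` is the radial field `(x, y) ↦ (0, y)`. Being linear it is its own derivative, and the
  -- product rule produces the term in `(0, w.2)`.
  let R : Model n × Model n →L[ℝ] Model n × Model n :=
    (ContinuousLinearMap.inr ℝ (Model n) (Model n)).comp (ContinuousLinearMap.snd ℝ _ _)
  have h1 : fderiv ℝ (fun y => fderiv ℝ f y (R y)) z = fderiv ℝ (fun y => 2 * f y) z :=
    Filter.EventuallyEq.fderiv_eq (he.mono fun y hy => by simpa [R] using hy)
  rw [fderiv_clm_apply (differentiableAt_fderiv hf) R.differentiableAt,
    fderiv_const_mul (hf.differentiableAt (by simp)), R.fderiv] at h1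
  have h2 := congrArg (fun A => A w) h1
  simp [R] at h2
  linarith

/-- The `1`-form `-∂F/∂yʲ dxʲ`. -/
def localHilbertForm (f : Model n × Model n → ℝ) (z : Model n × Model n) :
    Model n × Model n →L[ℝ] ℝ :=
  -(fderiv ℝ f z).comp ((ContinuousLinearMap.inr ℝ (Model n) (Model n)).comp
    (ContinuousLinearMap.fst ℝ (Model n) (Model n)))

theorem localHilbertForm_apply (v : Model n × Model n) :
    localHilbertForm f z v = -fderiv ℝ f z (0, v.1) := by
  simp [localHilbertForm]

theorem contDiffAt_localHilbertForm (hf : ContDiffAt ℝ ∞ f z) :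
    ContDiffAt ℝ ∞ (localHilbertForm f) z :=
  ((hf.fderiv_right (m := ∞) (by simp)).clm_comp contDiffAt_const).neg

theorem fderiv_localHilbertForm (hf : ContDiffAt ℝ ∞ f z) (v w : Model n × Model n) :
    fderiv ℝ (localHilbertForm f) z v w = -fderiv ℝ (fderiv ℝ f) z v (0, w.1) := by
  have h := fderiv_clm_apply (contDiffAt_localHilbertForm hf |>.differentiableAt (by simp))
    (differentiableAt_const w)
  have h2 : fderiv ℝ (fun y => localHilbertForm f y w) z v =
      fderiv ℝ (localHilbertForm f) z v w := by
    rw [h]; simp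
  rw [← h2]
  simp only [localHilbertForm_apply]
  rw [fderiv_fun_neg, ← fderiv_fderiv_apply hf]
  simp

/-- Fixes the convention for `d`: there is no factor `1/2`, so the Hamiltonian of the spray is
exactly `L²/2`. -/
theorem extDeriv_ofSubsingleton {E : Type*} [NormedAddCommGroup E] [NormedSpace ℝ E]
    {β : E → E →L[ℝ] ℝ} {z : E} (hβ : DifferentiableAt ℝ β z) (v w : E) :
    extDeriv (fun y => ContinuousAlternatingMap.ofSubsingleton ℝ E ℝ (0 : Fin 1) (β y)) z ![v, w] =
      fderiv ℝ β z v w - fderiv ℝ β z w v := by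
  have hd : DifferentiableAt ℝ
      (fun y => ContinuousAlternatingMap.ofSubsingleton ℝ E ℝ (0 : Fin 1) (β y)) z :=
    (ContinuousAlternatingMap.ofSubsingletonLIE (𝕜 := ℝ) (E := E) (F := ℝ)
      (0 : Fin 1)).toContinuousLinearEquiv.differentiableAt.comp z hβ
  have happ (a b : E) : fderiv ℝ (fun y => β y a) z b = fderiv ℝ β z b a := by
    rw [fderiv_clm_apply hβ (differentiableAt_const a)]; simp
  rw [extDeriv_apply hd]
  simp [Fin.sum_univ_two, Fin.removeNth, happ, sub_eq_add_neg]

theorem extDeriv_localHilbertForm (hf : ContDiffAt ℝ ∞ f z) (v w : Model n × Model n) :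
    extDeriv (fun y => ContinuousAlternatingMap.ofSubsingleton ℝ (Model n × Model n) ℝ (0 : Fin 1)
      (localHilbertForm f y)) z ![v, w] =
      fderiv ℝ (fderiv ℝ f) z w (0, v.1) - fderiv ℝ (fderiv ℝ f) z v (0, w.1) := by
  rw [extDeriv_ofSubsingleton (contDiffAt_localHilbertForm hf |>.differentiableAt (by simp)),
    fderiv_localHilbertForm hf, fderiv_localHilbertForm hf]
  ring

end Local

/-! ### The metric matrix and the spray in coordinates. -/

section Metric

variable {n : ℕ} {M : Type*} [TopologicalSpace M] [ChartedSpace (Model n) M]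
  {L : TangentBundle (𝓡 n) M → ℝ}
  {φ : OpenPartialHomeomorph M (Model n)} {z : Model n × Model n}

theorem metricMatrix_apply (hf : ContDiffAt ℝ ∞ (localEnergy L φ) z) (i j : Fin n) :
    metricMatrix L φ z i j =
      fderiv ℝ (fderiv ℝ (localEnergy L φ)) z (0, stdVec i) (0, stdVec j) :=
  fderiv_fderiv_apply hf _ _

theorem metricMatrix_symm (hf : ContDiffAt ℝ ∞ (localEnergy L φ) z) (i j : Fin n) :
    metricMatrix L φ z i j = metricMatrix L φ z j i := by
  rw [metricMatrix_apply hf, metricMatrix_apply hf, fderiv_fderiv_symm hf]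

theorem sum_metricMatrix_mul (hf : ContDiffAt ℝ ∞ (localEnergy L φ) z) (v : Model n) (j : Fin n) :
    ∑ i, metricMatrix L φ z i j * v i =
      fderiv ℝ (fderiv ℝ (localEnergy L φ)) z (0, v) (0, stdVec j) := by
  have h : ((0, v) : Model n × Model n) = ∑ i, v i • ((0 : Model n), stdVec i) := by
    simpa using sum_smul_stdVec_prod 0 v
  rw [h, map_sum, sum_apply]
  refine Finset.sum_congr rfl fun i _ => ?_
  rw [map_smul, metricMatrix_apply hf]
  simp [mul_comm]

theorem sprayCovector_eq (hf : ContDiffAt ℝ ∞ (localEnergy L φ) z) (j : Fin n) :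
    sprayCovector L φ z j =
      1 / 2 * (fderiv ℝ (fderiv ℝ (localEnergy L φ)) z (0, stdVec j) (z.2, 0) -
        fderiv ℝ (localEnergy L φ) z (stdVec j, 0)) := by
  have h : ((z.2, 0) : Model n × Model n) = ∑ i, z.2 i • (stdVec i, (0 : Model n)) := by
    simpa using sum_smul_stdVec_prod z.2 0
  rw [sprayCovector, h, map_sum]
  congr 2
  refine Finset.sum_congr rfl fun i _ => ?_
  rw [map_smul, smul_eq_mul, mul_comm]
  congr 1
  exact fderiv_fderiv_apply hf _ _

/-- The spray coefficients as a vector. -/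
def sprayVector (L : TangentBundle (𝓡 n) M → ℝ) (φ : OpenPartialHomeomorph M (Model n))
    (z : Model n × Model n) : Model n :=
  ∑ i, sprayCoeff L φ z i • stdVec i

theorem sprayVector_apply (i : Fin n) : sprayVector L φ z i = sprayCoeff L φ z i := by
  simp [sprayVector, stdVec, Pi.single_apply]

/-- This is `g_{ij} Gⁱ = G_j` contracted with `vʲ`: the inverse matrix cancels, and the index sums
are absorbed into the bilinear map `D²F`. Symmetry of `g` turns the contraction into a matrix-vector
product. -/
theorem fderiv_fderiv_sprayVector (hf : ContDiffAt ℝ ∞ (localEnergy L φ) z)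
    (hg : (metricMatrix L φ z).det ≠ 0) (v : Model n) :
    fderiv ℝ (fderiv ℝ (localEnergy L φ)) z (0, sprayVector L φ z) (0, v) =
      1 / 2 * (fderiv ℝ (fderiv ℝ (localEnergy L φ)) z (0, v) (z.2, 0) -
        fderiv ℝ (localEnergy L φ) z (v, 0)) := by
  have hj (j : Fin n) : fderiv ℝ (fderiv ℝ (localEnergy L φ)) z (0, sprayVector L φ z)
      (0, stdVec j) = sprayCovector L φ z j := by
    rw [← sum_metricMatrix_mul hf]
    simp only [sprayVector_apply, metricMatrix_symm hf _ j]
    have h : metricMatrix L φ z *ᵥ ((metricMatrix L φ z)⁻¹ *ᵥ sprayCovector L φ z) =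
        sprayCovector L φ z := by
      rw [Matrix.mulVec_mulVec, Matrix.mul_nonsing_inv _ (isUnit_iff_ne_zero.2 hg),
        Matrix.one_mulVec]
    exact congrFun h j
  have h : ((0, v) : Model n × Model n) = ∑ i, v i • ((0 : Model n), stdVec i) := by
    simpa using sum_smul_stdVec_prod 0 v
  have h' : ((v, 0) : Model n × Model n) = ∑ i, v i • (stdVec i, (0 : Model n)) := by
    simpa using sum_smul_stdVec_prod v 0
  rw [h, h', map_sum, map_sum, map_sum, sum_apply, ← Finset.sum_sub_distrib,
    Finset.mul_sum]
  refine Finset.sum_congr rfl fun i _ => ?_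
  simp only [map_smul, smul_apply, smul_eq_mul, hj, sprayCovector_eq hf]
  ring

/-- The geodesic spray in coordinates. -/
def localSpray (L : TangentBundle (𝓡 n) M → ℝ) (φ : OpenPartialHomeomorph M (Model n))
    (z : Model n × Model n) : Model n × Model n :=
  (z.2, -(2 : ℝ) • sprayVector L φ z)

/-- The differentiated Euler identity gives `D²F(w, (0, y)) = 2 DF(w) - DF(0, w₂)`. In `D²F((y,
-2G), (0, w₁))` the mixed term `D²F((y, 0), (0, w₁))` cancels against the one in `2G`, leaving
`DF(w₁, 0)`. The difference is `DF(w)`. -/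
theorem extDeriv_localSpray (hf : ContDiffAt ℝ ∞ (localEnergy L φ) z)
    (he : ∀ᶠ y in 𝓝 z, fderiv ℝ (localEnergy L φ) y (0, y.2) = 2 * localEnergy L φ y)
    (hg : (metricMatrix L φ z).det ≠ 0) (w : Model n × Model n) :
    extDeriv (fun y => ContinuousAlternatingMap.ofSubsingleton ℝ (Model n × Model n) ℝ (0 : Fin 1)
      (localHilbertForm (localEnergy L φ) y)) z ![localSpray L φ z, w] =
      fderiv ℝ (localEnergy L φ) z w := by
  have h1 : localSpray L φ z = (z.2, 0) + -(2 : ℝ) • ((0 : Model n), sprayVector L φ z) := by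
    simp [localSpray]
  have h2 : fderiv ℝ (localEnergy L φ) z w =
      fderiv ℝ (localEnergy L φ) z (w.1, 0) + fderiv ℝ (localEnergy L φ) z (0, w.2) := by
    rw [← map_add]; simp
  rw [extDeriv_localHilbertForm hf]
  change fderiv ℝ (fderiv ℝ (localEnergy L φ)) z w (0, z.2) - _ = _
  rw [fderiv_fderiv_radial hf he, h1, map_add, map_smul]
  simp only [add_apply, smul_apply, smul_eq_mul]
  rw [fderiv_fderiv_sprayVector hf hg, fderiv_fderiv_symm hf (z.2, 0)]
  linarith

/-- Testing against vertical vectors `(0, eⱼ)` gives `g v₁ = 0`. Once `v₁ = 0`, testing against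
`(eⱼ, 0)` gives `g v₂ = 0`. -/
theorem eq_zero_of_extDeriv_localHilbertForm (hf : ContDiffAt ℝ ∞ (localEnergy L φ) z)
    (hg : (metricMatrix L φ z).det ≠ 0) {v : Model n × Model n}
    (hv : ∀ w, extDeriv (fun y => ContinuousAlternatingMap.ofSubsingleton ℝ
      (Model n × Model n) ℝ (0 : Fin 1) (localHilbertForm (localEnergy L φ) y)) z ![v, w] = 0) :
    v = 0 := by
  have key (u : Model n) (hu : ∀ j, fderiv ℝ (fderiv ℝ (localEnergy L φ)) z (0, u)
      (0, stdVec j) = 0) : u = 0 := by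
    have h := Matrix.eq_zero_of_mulVec_eq_zero hg (v := fun i => u i) <| by
      funext j
      simpa [← sum_metricMatrix_mul hf, Matrix.mulVec, dotProduct,
        metricMatrix_symm hf j] using hu j
    ext i
    exact congrFun h i
  have h1 : v.1 = 0 := key _ fun j => by
    have := hv (0, stdVec j)
    rw [extDeriv_localHilbertForm hf] at this
    rw [fderiv_fderiv_symm hf]
    simpa [← Prod.zero_eq_mk] using this
  have h2 : v.2 = 0 := key _ fun j => by
    have := hv (stdVec j, 0)
    rw [extDeriv_localHilbertForm hf] at this
    have e : v = (0, v.2) := Prod.ext h1 rfl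
    rw [← e]
    simpa [h1, ← Prod.zero_eq_mk] using this
  exact Prod.ext h1 h2

theorem contDiffAt_metricMatrix (hf : ContDiffAt ℝ ∞ (localEnergy L φ) z) (i j : Fin n) :
    ContDiffAt ℝ ∞ (fun y => metricMatrix L φ y i j) z := by
  have h1 : ContDiffAt ℝ ∞ (partialY j (localEnergy L φ)) z :=
    (hf.fderiv_right (m := ∞) (by simp)).clm_apply contDiffAt_const
  exact (h1.fderiv_right (m := ∞) (by simp)).clm_apply contDiffAt_const

theorem contDiffAt_det {E : Type*} [NormedAddCommGroup E] [NormedSpace ℝ E]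
    {A : E → Matrix (Fin n) (Fin n) ℝ} {z : E}
    (hA : ∀ i j, ContDiffAt ℝ ∞ (fun y => A y i j) z) :
    ContDiffAt ℝ ∞ (fun y => (A y).det) z := by
  simp only [Matrix.det_apply]
  exact ContDiffAt.sum fun σ _ => (contDiffAt_prod fun i _ => hA _ _).const_smul _

/-- Cramer's rule: the entries are determinants, with one row replaced by a constant, divided by a
non-vanishing determinant. -/
theorem contDiffAt_matrix_inv {E : Type*} [NormedAddCommGroup E] [NormedSpace ℝ E]
    {A : E → Matrix (Fin n) (Fin n) ℝ} {z : E}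
    (hA : ∀ i j, ContDiffAt ℝ ∞ (fun y => A y i j) z) (h0 : (A z).det ≠ 0) (i j : Fin n) :
    ContDiffAt ℝ ∞ (fun y => (A y)⁻¹ i j) z := by
  simp only [Matrix.inv_def, Matrix.smul_apply, Ring.inverse_eq_inv', smul_eq_mul,
    Matrix.adjugate_apply]
  refine ((contDiffAt_det hA).inv h0).mul (contDiffAt_det fun k l => ?_)
  simp only [Matrix.updateRow_apply]
  split_ifs
  · exact contDiffAt_const
  · exact hA k l

theorem contDiffAt_localSpray (hf : ContDiffAt ℝ ∞ (localEnergy L φ) z)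
    (hg : (metricMatrix L φ z).det ≠ 0) : ContDiffAt ℝ ∞ (localSpray L φ) z := by
  have hX (i : Fin n) : ContDiffAt ℝ ∞ (partialX i (localEnergy L φ)) z :=
    (hf.fderiv_right (m := ∞) (by simp)).clm_apply contDiffAt_const
  have hYX (i j : Fin n) : ContDiffAt ℝ ∞ (partialY j (partialX i (localEnergy L φ))) z :=
    ((hX i).fderiv_right (m := ∞) (by simp)).clm_apply contDiffAt_const
  have hy (i : Fin n) : ContDiffAt ℝ ∞ (fun y : Model n × Model n => y.2 i) z := by
    fun_prop
  have hcov (j : Fin n) : ContDiffAt ℝ ∞ (fun y => sprayCovector L φ y j) z :=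
    contDiffAt_const.mul ((ContDiffAt.sum fun i _ => (hYX i j).mul (hy i)).sub (hX j))
  have hcoeff (i : Fin n) : ContDiffAt ℝ ∞ (fun y => sprayCoeff L φ y i) z :=
    ContDiffAt.sum fun j _ =>
      (contDiffAt_matrix_inv (contDiffAt_metricMatrix hf) hg i j).mul (hcov j)
  exact contDiffAt_snd.prodMk
    (ContDiffAt.const_smul _ (f := sprayVector L φ)
      (ContDiffAt.sum fun i _ => (hcoeff i).smul contDiffAt_const))

end Metric

/-! ### Charts of `TM` induced by charts of `M`. -/

section TangentCoordinates

variable {n : ℕ} {M : Type*} [TopologicalSpace M] [ChartedSpace (Model n) M]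
  {φ : OpenPartialHomeomorph M (Model n)}

theorem mdifferentiable_of_mem_maximalAtlas (hφ : φ ∈ IsManifold.maximalAtlas (𝓡 n) ∞ M) :
    φ.MDifferentiable (𝓡 n) (𝓡 n) :=
  ⟨(contMDiffOn_of_mem_maximalAtlas hφ).mdifferentiableOn (by simp),
    (contMDiffOn_symm_of_mem_maximalAtlas hφ).mdifferentiableOn (by simp)⟩

theorem coordsOfVector_vectorOfCoords (hφ : φ ∈ IsManifold.maximalAtlas (𝓡 n) ∞ M)
    {z : Model n × Model n} (hz : z.1 ∈ φ.target) :
    coordsOfVector φ (vectorOfCoords φ z : TangentBundle (𝓡 n) M) = z := by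
  refine Prod.ext (φ.right_inv hz) ?_
  exact congrArg (fun A => A z.2) ((mdifferentiable_of_mem_maximalAtlas hφ).comp_symm_deriv hz)

/-- Base point and vector are kept separate because `hilbertFormIn_apply` moves the vector within a
fixed fibre. -/
theorem vectorOfCoords_mfderiv (hφ : φ ∈ IsManifold.maximalAtlas (𝓡 n) ∞ M)
    {x : M} (hx : x ∈ φ.source) (v : TangentSpace (𝓡 n) x) :
    vectorOfCoords φ (φ x, mfderiv (𝓡 n) (𝓡 n) φ x v) = (⟨x, v⟩ : TangentBundle (𝓡 n) M) := by
  have h : mfderiv (𝓡 n) (𝓡 n) φ.symm (φ x) (mfderiv (𝓡 n) (𝓡 n) φ x v) = v :=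
    congrArg (fun A => A v) ((mdifferentiable_of_mem_maximalAtlas hφ).symm_comp_deriv hx)
  unfold vectorOfCoords
  simp only [h]
  exact congrArg (fun y : M => (⟨y, v⟩ : TangentBundle (𝓡 n) M)) (φ.left_inv hx)

theorem vectorOfCoords_coordsOfVector (hφ : φ ∈ IsManifold.maximalAtlas (𝓡 n) ∞ M)
    {p : TangentBundle (𝓡 n) M} (hp : p.1 ∈ φ.source) :
    vectorOfCoords φ (coordsOfVector φ p) = p :=
  vectorOfCoords_mfderiv hφ hp p.2

variable [IsManifold (𝓡 n) ∞ M]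

theorem contMDiff_totalSpaceMk_model :
    ContMDiff 𝓘(ℝ, Model n × Model n) (𝓡 n).tangent ∞
      (fun z : Model n × Model n => (⟨z.1, z.2⟩ : TangentBundle (𝓡 n) (Model n))) := by
  intro z
  rw [Bundle.contMDiffAt_totalSpace]
  refine ⟨contDiff_fst.contMDiff.contMDiffAt, ?_⟩
  simp only [trivializationAt_model_space_apply]
  exact (contDiff_snd (𝕜 := ℝ) (E := Model n) (F := Model n) (n := ∞)).contMDiff.contMDiffAt

/-- `vectorOfCoords φ` is the tangent map of `φ.symm` after identifying `ℝⁿ × ℝⁿ` with the tangent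
bundle of `ℝⁿ`. -/
theorem contMDiffAt_vectorOfCoords (hφ : φ ∈ IsManifold.maximalAtlas (𝓡 n) ∞ M)
    {z : Model n × Model n} (hz : z.1 ∈ φ.target) :
    ContMDiffAt 𝓘(ℝ, Model n × Model n) (𝓡 n).tangent ∞
      (vectorOfCoords φ : Model n × Model n → TangentBundle (𝓡 n) M) z := by
  have h := (contMDiffOn_symm_of_mem_maximalAtlas hφ).contMDiffOn_tangentMapWithin (m := ∞)
    (by simp) φ.open_target.uniqueMDiffOn
  have hopen : IsOpen ((fun z : Model n × Model n => z.1) ⁻¹' φ.target) :=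
    φ.open_target.preimage continuous_fst
  have h2 := h.comp (contMDiff_totalSpaceMk_model (n := n)).contMDiffOn
    (s := (fun z : Model n × Model n => z.1) ⁻¹' φ.target) (fun z hz => hz)
  refine (h2.contMDiffAt (hopen.mem_nhds hz)).congr_of_eventuallyEq ?_
  filter_upwards [hopen.mem_nhds hz] with y hy
  simp only [Function.comp, tangentMapWithin, vectorOfCoords,
    mfderivWithin_of_isOpen φ.open_target hy]

theorem isOpen_proj_preimage_source :
    IsOpen ((fun p : TangentBundle (𝓡 n) M => p.1) ⁻¹' φ.source) :=
  φ.open_source.preimage (FiberBundle.continuous_proj _ _)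

theorem contMDiffAt_coordsOfVector (hφ : φ ∈ IsManifold.maximalAtlas (𝓡 n) ∞ M)
    {p : TangentBundle (𝓡 n) M} (hp : p.1 ∈ φ.source) :
    ContMDiffAt (𝓡 n).tangent 𝓘(ℝ, Model n × Model n) ∞ (coordsOfVector φ) p := by
  have h := (contMDiffOn_of_mem_maximalAtlas hφ).contMDiffOn_tangentMapWithin (m := ∞)
    (by simp) φ.open_source.uniqueMDiffOn
  have hopen := isOpen_proj_preimage_source (n := n) (M := M) (φ := φ)
  have h2 := contMDiff_snd_tangentBundle_modelSpace (Model n) (𝓡 n) (n := ∞)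
  have h3 := (h2.comp_contMDiffOn h).contMDiffAt (hopen.mem_nhds hp)
  have h4 : ContMDiffAt (𝓡 n).tangent 𝓘(ℝ, Model n) ∞
      (fun q : TangentBundle (𝓡 n) M => φ q.1) p :=
    (contMDiffAt_of_mem_maximalAtlas hφ hp).comp p
      (Bundle.contMDiff_proj (TangentSpace (𝓡 n))).contMDiffAt
  refine (h4.prodMk_space h3).congr_of_eventuallyEq ?_
  filter_upwards [hopen.mem_nhds hp] with q hq
  simp only [Function.comp, tangentMapWithin, coordsOfVector,
    mfderivWithin_of_isOpen φ.open_source hq]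

/-- Links the preferred charts of `TM`, in which smoothness of forms is defined, to the coordinates
`(x, y)`. -/
theorem extChartAt_tangent_symm_eventuallyEq (p : TangentBundle (𝓡 n) M) :
    ((extChartAt (𝓡 n).tangent p).symm : Model n × Model n → TangentBundle (𝓡 n) M)
      =ᶠ[𝓝 (extChartAt (𝓡 n).tangent p p)] vectorOfCoords (chartAt (Model n) p.1) := by
  have hopen : IsOpen ((fun z : Model n × Model n => z.1) ⁻¹' (chartAt (Model n) p.1).target) :=
    (chartAt (Model n) p.1).open_target.preimage continuous_fst
  have hmem : extChartAt (𝓡 n).tangent p p ∈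
      (fun z : Model n × Model n => z.1) ⁻¹' (chartAt (Model n) p.1).target := by
    exact mem_chart_target (Model n) p.1
  filter_upwards [hopen.mem_nhds hmem] with z hz
  exact (tangentMap_chart_symm (I := 𝓡 n) (p := p)
    (q := (⟨z.1, z.2⟩ : TangentBundle (𝓡 n) (Model n))) hz).symm

theorem mfderiv_coordsOfVector_comp (hφ : φ ∈ IsManifold.maximalAtlas (𝓡 n) ∞ M)
    {z : Model n × Model n} (hz : z.1 ∈ φ.target) (v : Model n × Model n) :
    mfderiv (𝓡 n).tangent 𝓘(ℝ, Model n × Model n) (coordsOfVector φ)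
      (vectorOfCoords φ z : TangentBundle (𝓡 n) M)
      (mfderiv 𝓘(ℝ, Model n × Model n) (𝓡 n).tangent (vectorOfCoords φ) z v) = v := by
  have hopen : IsOpen ((fun z : Model n × Model n => z.1) ⁻¹' φ.target) :=
    φ.open_target.preimage continuous_fst
  have h := mfderiv_comp z
    ((contMDiffAt_coordsOfVector hφ (p := vectorOfCoords φ z)
      (φ.map_target hz)).mdifferentiableAt (by simp))
    ((contMDiffAt_vectorOfCoords hφ hz).mdifferentiableAt (by simp))
  have h2 : (coordsOfVector φ ∘ (vectorOfCoords φ : _ → TangentBundle (𝓡 n) M)) =ᶠ[𝓝 z] id := by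
    filter_upwards [hopen.mem_nhds hz] with y hy
    exact coordsOfVector_vectorOfCoords hφ hy
  rw [h2.mfderiv_eq, mfderiv_id] at h
  exact (congrArg (fun A => A v) h).symm

theorem mfderiv_vectorOfCoords_comp (hφ : φ ∈ IsManifold.maximalAtlas (𝓡 n) ∞ M)
    {p : TangentBundle (𝓡 n) M} (hp : p.1 ∈ φ.source) (w : TangentSpace (𝓡 n).tangent p) :
    mfderiv 𝓘(ℝ, Model n × Model n) (𝓡 n).tangent (vectorOfCoords φ) (coordsOfVector φ p)
      (mfderiv (𝓡 n).tangent 𝓘(ℝ, Model n × Model n) (coordsOfVector φ) p w) = w := by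
  have hopen := isOpen_proj_preimage_source (n := n) (M := M) (φ := φ)
  have h := mfderiv_comp p
    ((contMDiffAt_vectorOfCoords hφ (z := coordsOfVector φ p)
      (φ.map_source hp)).mdifferentiableAt (by simp))
    ((contMDiffAt_coordsOfVector hφ hp).mdifferentiableAt (by simp))
  have h2 : ((vectorOfCoords φ : _ → TangentBundle (𝓡 n) M) ∘ coordsOfVector φ) =ᶠ[𝓝 p] id := by
    filter_upwards [hopen.mem_nhds hp] with y hy
    exact vectorOfCoords_coordsOfVector hφ hy
  rw [h2.mfderiv_eq, mfderiv_id] at h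
  exact (congrArg (fun A => A w) h).symm

/-- `dxʲ` in the coordinates `(x, y)`. -/
theorem coordCovecX_mfderiv_vectorOfCoords (hφ : φ ∈ IsManifold.maximalAtlas (𝓡 n) ∞ M)
    {z : Model n × Model n} (hz : z.1 ∈ φ.target) (v : Model n × Model n) (j : Fin n) :
    coordCovecX φ j (vectorOfCoords φ z : TangentBundle (𝓡 n) M)
      (mfderiv 𝓘(ℝ, Model n × Model n) (𝓡 n).tangent (vectorOfCoords φ) z v) = v.1 j := by
  let P : Model n × Model n →L[ℝ] ℝ :=
    (EuclideanSpace.proj j).comp (ContinuousLinearMap.fst ℝ (Model n) (Model n))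
  have h := mfderiv_comp (vectorOfCoords φ z : TangentBundle (𝓡 n) M)
    (P.differentiableAt (x := coordsOfVector φ (vectorOfCoords φ z))).mdifferentiableAt
    ((contMDiffAt_coordsOfVector hφ (p := vectorOfCoords φ z)
      (φ.map_target hz)).mdifferentiableAt (by simp))
  rw [mfderiv_eq_fderiv, P.fderiv] at h
  have h2 := congrArg (fun A => A
    (mfderiv 𝓘(ℝ, Model n × Model n) (𝓡 n).tangent (vectorOfCoords φ) z v)) h
  refine h2.trans ?_
  exact congrArg P (mfderiv_coordsOfVector_comp hφ hz v)

end TangentCoordinates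

/-! ### Linearity of a `2`-form in its first argument. -/

section Alternating

theorem update_vecCons_zero {E : Type*} [Zero E] (u w : E) :
    Function.update ![0, w] 0 u = ![u, w] :=
  Fin.update_cons_zero _ _ _

variable {E : Type*} [AddCommGroup E] [Module ℝ E] [TopologicalSpace E]
  (α : E [⋀^Fin 2]→L[ℝ] ℝ)

theorem map_vecCons_sub (u v w : E) : α ![u - v, w] = α ![u, w] - α ![v, w] := by
  simpa only [update_vecCons_zero] using α.map_update_sub ![0, w] 0 u v

theorem map_vecCons_smul (c : ℝ) (u w : E) : α ![c • u, w] = c * α ![u, w] := by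
  simpa only [update_vecCons_zero, smul_eq_mul] using α.map_update_smul ![0, w] 0 c u

end Alternating

/-- Both sides are the derivative of `φ ∘ π`, by two applications of the chain rule. -/
theorem fst_mfderiv_coordsOfVector {n : ℕ} {M : Type*} [TopologicalSpace M]
    [ChartedSpace (Model n) M] [IsManifold (𝓡 n) ∞ M] {φ : OpenPartialHomeomorph M (Model n)}
    (hφ : φ ∈ IsManifold.maximalAtlas (𝓡 n) ∞ M) {p : TangentBundle (𝓡 n) M}
    (hp : p.1 ∈ φ.source) (w : TangentSpace (𝓡 n).tangent p) :
    (mfderiv (𝓡 n).tangent 𝓘(ℝ, Model n × Model n) (coordsOfVector φ) p w :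
      Model n × Model n).1 = mfderiv (𝓡 n) (𝓡 n) φ p.1
        (mfderiv (𝓡 n).tangent (𝓡 n) (fun q : TangentBundle (𝓡 n) M => q.1) p w) := by
  have h1 := mfderiv_comp p (I' := 𝓘(ℝ, Model n × Model n)) (I'' := 𝓘(ℝ, Model n))
    (ContinuousLinearMap.fst ℝ (Model n) (Model n)).differentiableAt.mdifferentiableAt
    ((contMDiffAt_coordsOfVector hφ hp).mdifferentiableAt (by simp))
  have h2 := mfderiv_comp p (I' := 𝓡 n) (I'' := 𝓡 n)
    (f := fun q : TangentBundle (𝓡 n) M => q.1)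
    ((contMDiffAt_of_mem_maximalAtlas hφ hp).mdifferentiableAt (by simp))
    ((Bundle.contMDiff_proj (n := ∞) (TangentSpace (𝓡 n))).contMDiffAt.mdifferentiableAt (by simp))
  rw [mfderiv_eq_fderiv, ContinuousLinearMap.fderiv] at h1
  exact congrArg (fun A => A w) (h1.symm.trans h2)

/-! ### Homogeneity, Euler's identity and the Hilbert form of a Finsler metric. -/

namespace FinslerMetric

variable {n : ℕ} {M : Type*} [TopologicalSpace M] [ChartedSpace (Model n) M]
  [IsManifold (𝓡 n) ∞ M] (𝓕 : FinslerMetric n M) {φ : OpenPartialHomeomorph M (Model n)}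

/-- The domain of the metric in the coordinates induced by `φ`. -/
def coordDomain (φ : OpenPartialHomeomorph M (Model n)) : Set (Model n × Model n) :=
  {z | z.1 ∈ φ.target ∧ (vectorOfCoords φ z : TangentBundle (𝓡 n) M) ∈ 𝓕.domain}

variable {𝓕}

theorem coordDomain_mem_nhds (hφ : φ ∈ IsManifold.maximalAtlas (𝓡 n) ∞ M)
    {z : Model n × Model n} (hz : z ∈ 𝓕.coordDomain φ) : 𝓕.coordDomain φ ∈ 𝓝 z :=
  inter_mem ((φ.open_target.preimage continuous_fst).mem_nhds hz.1)
    ((contMDiffAt_vectorOfCoords hφ hz.1).continuousAt.preimage_mem_nhds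
      (𝓕.isOpen_domain.mem_nhds hz.2))

theorem coordsOfVector_mem (hφ : φ ∈ IsManifold.maximalAtlas (𝓡 n) ∞ M)
    {p : TangentBundle (𝓡 n) M} (hp : p ∈ 𝓕.domain) (hpφ : p.1 ∈ φ.source) :
    coordsOfVector φ p ∈ 𝓕.coordDomain φ := by
  refine ⟨φ.map_source hpφ, ?_⟩
  rwa [vectorOfCoords_coordsOfVector hφ hpφ]

theorem contMDiffAt_L {p : TangentBundle (𝓡 n) M} (hp : p ∈ 𝓕.domain) :
    ContMDiffAt (𝓡 n).tangent 𝓘(ℝ, ℝ) ∞ 𝓕.L p :=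
  𝓕.smooth.contMDiffAt (𝓕.isOpen_domain.mem_nhds hp)

theorem contMDiffAt_energy {p : TangentBundle (𝓡 n) M} (hp : p ∈ 𝓕.domain) :
    ContMDiffAt (𝓡 n).tangent 𝓘(ℝ, ℝ) ∞ (energy 𝓕.L) p := by
  have h : ContDiff ℝ ∞ (fun t : ℝ => 1 / 2 * t ^ 2) := by fun_prop
  exact h.contMDiff.contMDiffAt.comp p (contMDiffAt_L hp)

theorem contDiffAt_localEnergy (hφ : φ ∈ IsManifold.maximalAtlas (𝓡 n) ∞ M)
    {z : Model n × Model n} (hz : z ∈ 𝓕.coordDomain φ) :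
    ContDiffAt ℝ ∞ (localEnergy 𝓕.L φ) z :=
  ((contMDiffAt_energy hz.2).comp z (contMDiffAt_vectorOfCoords hφ hz.1)).contDiffAt

theorem det_metricMatrix_ne_zero (hφ : φ ∈ IsManifold.maximalAtlas (𝓡 n) ∞ M)
    {z : Model n × Model n} (hz : z ∈ 𝓕.coordDomain φ) :
    (metricMatrix 𝓕.L φ z).det ≠ 0 := by
  have h := 𝓕.regular φ hφ _ hz.2 (φ.map_target hz.1)
  rwa [coordsOfVector_vectorOfCoords hφ hz.1] at h

theorem localEnergy_smul {z : Model n × Model n} (hz : z ∈ 𝓕.coordDomain φ) {c : ℝ} (hc : 0 < c) :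
    localEnergy 𝓕.L φ (z.1, c • z.2) = c ^ 2 * localEnergy 𝓕.L φ z := by
  have h := 𝓕.homogeneous _ _ c hc hz.2
  have e : (vectorOfCoords φ (z.1, c • z.2) : TangentBundle (𝓡 n) M) =
      ⟨φ.symm z.1, c • mfderiv (𝓡 n) (𝓡 n) φ.symm z.1 z.2⟩ := by
    exact congrArg (fun v => (⟨φ.symm z.1, v⟩ : TangentBundle (𝓡 n) M))
      ((mfderiv (𝓡 n) (𝓡 n) φ.symm z.1).map_smul c z.2)
  simp only [localEnergy, energy]
  rw [e, h]
  unfold vectorOfCoords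
  ring

/-- Euler's identity for `F`, which is homogeneous of degree `2`. -/
theorem fderiv_localEnergy_radial (hφ : φ ∈ IsManifold.maximalAtlas (𝓡 n) ∞ M)
    {z : Model n × Model n} (hz : z ∈ 𝓕.coordDomain φ) :
    fderiv ℝ (localEnergy 𝓕.L φ) z (0, z.2) = 2 * localEnergy 𝓕.L φ z := by
  have hf : HasFDerivAt (localEnergy 𝓕.L φ) (fderiv ℝ (localEnergy 𝓕.L φ) z)
      (z.1, (1 : ℝ) • z.2) := by
    simpa using ((contDiffAt_localEnergy hφ hz).differentiableAt (by simp)).hasFDerivAt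
  have hl : HasDerivAt (fun t : ℝ => (z.1, t • z.2)) ((0 : Model n), z.2) 1 := by
    simpa using (hasDerivAt_const (1 : ℝ) z.1).prodMk ((hasDerivAt_id (1 : ℝ)).smul_const z.2)
  have h1 := hf.comp_hasDerivAt (1 : ℝ) hl
  have h2 : HasDerivAt (fun t : ℝ => t ^ 2 * localEnergy 𝓕.L φ z)
      (2 * localEnergy 𝓕.L φ z) 1 := by
    simpa using (hasDerivAt_pow 2 (1 : ℝ)).mul_const (localEnergy 𝓕.L φ z)
  -- Homogeneity is available only for `t > 0`, which suffices for the derivative at `t = 1`.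
  refine h1.unique (h2.congr_of_eventuallyEq ?_)
  filter_upwards [lt_mem_nhds (zero_lt_one (α := ℝ))] with t ht
  exact localEnergy_smul hz ht

theorem eventually_fderiv_localEnergy_radial (hφ : φ ∈ IsManifold.maximalAtlas (𝓡 n) ∞ M)
    {z : Model n × Model n} (hz : z ∈ 𝓕.coordDomain φ) :
    ∀ᶠ y in 𝓝 z, fderiv ℝ (localEnergy 𝓕.L φ) y (0, y.2) = 2 * localEnergy 𝓕.L φ y := by
  filter_upwards [coordDomain_mem_nhds hφ hz] with y hy
  exact fderiv_localEnergy_radial hφ hy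

theorem hilbertFormIn_vectorOfCoords (hφ : φ ∈ IsManifold.maximalAtlas (𝓡 n) ∞ M)
    {z : Model n × Model n} (hz : z ∈ 𝓕.coordDomain φ) (v : Model n × Model n) :
    hilbertFormIn 𝓕.L φ (vectorOfCoords φ z)
      (mfderiv 𝓘(ℝ, Model n × Model n) (𝓡 n).tangent (vectorOfCoords φ) z v) =
      localHilbertForm (localEnergy 𝓕.L φ) z v := by
  have hf := contDiffAt_localEnergy hφ hz
  -- The identity `g_{ij} yⁱ = F_{yʲ}`: the differentiated Euler identity in the direction `(0, eⱼ)`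
  -- reads `2 F_{yʲ} - F_{yʲ}`.
  have hj (j : Fin n) : ∑ i, metricMatrix 𝓕.L φ z i j * z.2 i =
      fderiv ℝ (localEnergy 𝓕.L φ) z (0, stdVec j) := by
    rw [sum_metricMatrix_mul hf, fderiv_fderiv_symm hf,
      fderiv_fderiv_radial hf (eventually_fderiv_localEnergy_radial hφ hz)]
    ring
  have h : ((0, v.1) : Model n × Model n) = ∑ i, v.1 i • ((0 : Model n), stdVec i) := by
    simpa using sum_smul_stdVec_prod 0 v.1
  rw [localHilbertForm_apply, h, map_sum, hilbertFormIn, coordsOfVector_vectorOfCoords hφ hz.1,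
    Finset.sum_comm]
  simp only [neg_apply, sum_apply, smul_apply, coordCovecX_mfderiv_vectorOfCoords hφ hz.1,
    map_smul, smul_eq_mul, ← Finset.sum_mul, hj]
  simp only [mul_comm]

/-- The right side does not involve `φ`, and chart independence of `η` follows at once. -/
theorem hilbertFormIn_apply (hφ : φ ∈ IsManifold.maximalAtlas (𝓡 n) ∞ M)
    {p : TangentBundle (𝓡 n) M} (hp : p ∈ 𝓕.domain) (hpφ : p.1 ∈ φ.source)
    (w : TangentSpace (𝓡 n).tangent p) :
    hilbertFormIn 𝓕.L φ p w = -deriv (fun t : ℝ => energy 𝓕.L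
      (⟨p.1, p.2 + t • mfderiv (𝓡 n).tangent (𝓡 n) (fun q : TangentBundle (𝓡 n) M => q.1) p w⟩ :
        TangentBundle (𝓡 n) M)) 0 := by
  have hz := coordsOfVector_mem hφ hp hpφ
  -- `vectorOfCoords φ (coordsOfVector φ p)` equals `p` only propositionally. Fixing the type of the
  -- argument as the model space lets the equality be substituted.
  have hcongr (q : TangentBundle (𝓡 n) M) (hq : q = p) (X : Model n × Model n) :
      (hilbertFormIn 𝓕.L φ q : Model n × Model n →L[ℝ] ℝ) X =
        (hilbertFormIn 𝓕.L φ p : Model n × Model n →L[ℝ] ℝ) X := by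
    subst hq
    rfl
  obtain ⟨V, hV⟩ : ∃ V : Model n × Model n,
    V = mfderiv (𝓡 n).tangent 𝓘(ℝ, Model n × Model n) (coordsOfVector φ) p w := ⟨_, rfl⟩
  have hV1 := (congrArg Prod.fst hV).trans (fst_mfderiv_coordsOfVector hφ hpφ w)
  have h1 : hilbertFormIn 𝓕.L φ p w =
      localHilbertForm (localEnergy 𝓕.L φ) (coordsOfVector φ p) V := by
    rw [hV]
    exact (congrArg (hilbertFormIn 𝓕.L φ p) (mfderiv_vectorOfCoords_comp hφ hpφ w).symm).trans
      ((hcongr _ (vectorOfCoords_coordsOfVector hφ hpφ) _).symm.trans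
        (hilbertFormIn_vectorOfCoords hφ hz _))
  rw [h1, localHilbertForm_apply, hV1]
  congr 1
  set u := mfderiv (𝓡 n).tangent (𝓡 n) (fun q : TangentBundle (𝓡 n) M => q.1) p w
  let U : Model n := mfderiv (𝓡 n) (𝓡 n) φ p.1 u
  have hf : HasFDerivAt (localEnergy 𝓕.L φ) (fderiv ℝ (localEnergy 𝓕.L φ) (coordsOfVector φ p))
      ((coordsOfVector φ p).1, (coordsOfVector φ p).2 + (0 : ℝ) • U) := by
    have := ((contDiffAt_localEnergy hφ hz).differentiableAt (by simp)).hasFDerivAt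
    simpa using this
  have hl : HasDerivAt (fun t : ℝ => ((coordsOfVector φ p).1, (coordsOfVector φ p).2 + t • U))
      ((0 : Model n), U) 0 := by
    simpa using (hasDerivAt_const (0 : ℝ) (coordsOfVector φ p).1).prodMk
      (((hasDerivAt_id (0 : ℝ)).smul_const U).const_add (coordsOfVector φ p).2)
  have h2 := hf.comp_hasDerivAt (0 : ℝ) hl
  rw [← h2.deriv]
  congr 1
  funext t
  refine congrArg (energy 𝓕.L) (Eq.trans ?_ (vectorOfCoords_mfderiv hφ hpφ (p.2 + t • u)))
  refine congrArg (vectorOfCoords φ) (Prod.ext rfl ?_)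
  exact (((mfderiv (𝓡 n) (𝓡 n) φ p.1).map_add p.2 (t • u)).trans
    (congrArg _ ((mfderiv (𝓡 n) (𝓡 n) φ p.1).map_smul t u))).symm

/-! ### The global Hilbert form and its exterior derivative. -/

theorem hilbertForm_eq (hφ : φ ∈ IsManifold.maximalAtlas (𝓡 n) ∞ M)
    {p : TangentBundle (𝓡 n) M} (hp : p ∈ 𝓕.domain) (hpφ : p.1 ∈ φ.source) :
    𝓕.hilbertForm p = hilbertFormIn 𝓕.L φ p := by
  ext w
  rw [hilbertFormIn_apply hφ hp hpφ, hilbertForm,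
    hilbertFormIn_apply (IsManifold.chart_mem_maximalAtlas p.1) hp (mem_chart_source _ p.1)]

/-- The Hilbert form as a differential form of degree `1`. -/
abbrev hilbertAlternating (𝓕 : FinslerMetric n M) (q : TangentBundle (𝓡 n) M) :
    TangentSpace (𝓡 n).tangent q [⋀^Fin 1]→L[ℝ] ℝ :=
  ContinuousAlternatingMap.ofSubsingleton ℝ (TangentSpace (𝓡 n).tangent q) ℝ (0 : Fin 1)
    (𝓕.hilbertForm q)

theorem pullbackForm_hilbertAlternating (hφ : φ ∈ IsManifold.maximalAtlas (𝓡 n) ∞ M)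
    {z : Model n × Model n} (hz : z ∈ 𝓕.coordDomain φ) :
    pullbackForm (𝓡 n).tangent 𝓕.hilbertAlternating (vectorOfCoords φ) =ᶠ[𝓝 z]
      fun y => ContinuousAlternatingMap.ofSubsingleton ℝ (Model n × Model n) ℝ (0 : Fin 1)
        (localHilbertForm (localEnergy 𝓕.L φ) y) := by
  filter_upwards [coordDomain_mem_nhds hφ hz] with y hy
  ext v
  refine Eq.trans ?_ (hilbertFormIn_vectorOfCoords hφ hy (v 0))
  rw [← hilbertForm_eq hφ hy.2 (φ.map_target hy.1)]
  rfl

theorem isSmoothFormOn_hilbertAlternating :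
    IsSmoothFormOn (𝓡 n).tangent 𝓕.hilbertAlternating 𝓕.domain := by
  intro p hp
  have hφ := IsManifold.chart_mem_maximalAtlas (I := 𝓡 n) (n := ∞) p.1
  have hext := extChartAt_tangent_symm_eventuallyEq p
  have hz : extChartAt (𝓡 n).tangent p p ∈ 𝓕.coordDomain (chartAt (Model n) p.1) := by
    refine ⟨mem_chart_target (Model n) p.1, ?_⟩
    rw [← hext.self_of_nhds, extChartAt_to_inv]
    exact hp
  rw [ModelWithCorners.range_eq_univ, contDiffWithinAt_univ, formInChart_eq_pullbackForm]
  exact ((ContinuousAlternatingMap.ofSubsingletonLIE (𝕜 := ℝ) (E := Model n × Model n) (F := ℝ)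
    (0 : Fin 1)).toContinuousLinearEquiv.contDiff.contDiffAt.comp _
      (contDiffAt_localHilbertForm (contDiffAt_localEnergy hφ hz))).congr_of_eventuallyEq
    ((pullbackForm_eventuallyEq hext).trans (pullbackForm_hilbertAlternating hφ hz))

theorem pullbackForm_dHilbertForm (hφ : φ ∈ IsManifold.maximalAtlas (𝓡 n) ∞ M)
    {z : Model n × Model n} (hz : z ∈ 𝓕.coordDomain φ) :
    pullbackForm (𝓡 n).tangent 𝓕.dHilbertForm (vectorOfCoords φ) z =
      extDeriv (fun y => ContinuousAlternatingMap.ofSubsingleton ℝ (Model n × Model n) ℝ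
        (0 : Fin 1) (localHilbertForm (localEnergy 𝓕.L φ) y)) z := by
  rw [← (pullbackForm_hilbertAlternating hφ hz).extDeriv_eq]
  have hd := isSmoothFormOn_hilbertAlternating (𝓕 := 𝓕) _ hz.2
  rw [ModelWithCorners.range_eq_univ, contDiffWithinAt_univ] at hd
  exact pullbackForm_extDerivForm _ (contMDiffAt_vectorOfCoords hφ hz.1)
    (hd.differentiableAt (by simp))

theorem dHilbertForm_apply (hφ : φ ∈ IsManifold.maximalAtlas (𝓡 n) ∞ M)
    {p : TangentBundle (𝓡 n) M} (hp : p ∈ 𝓕.domain) (hpφ : p.1 ∈ φ.source)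
    (v w : Model n × Model n) :
    𝓕.dHilbertForm p ![mfderiv 𝓘(ℝ, Model n × Model n) (𝓡 n).tangent (vectorOfCoords φ)
        (coordsOfVector φ p) v, mfderiv 𝓘(ℝ, Model n × Model n) (𝓡 n).tangent (vectorOfCoords φ)
        (coordsOfVector φ p) w] =
      extDeriv (fun y => ContinuousAlternatingMap.ofSubsingleton ℝ (Model n × Model n) ℝ
        (0 : Fin 1) (localHilbertForm (localEnergy 𝓕.L φ) y)) (coordsOfVector φ p) ![v, w] := by
  rw [← pullbackForm_dHilbertForm hφ (coordsOfVector_mem hφ hp hpφ)]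
  have hcongr (q : TangentBundle (𝓡 n) M) (hq : q = p) (X : Fin 2 → Model n × Model n) :
      (𝓕.dHilbertForm p : (Model n × Model n) [⋀^Fin 2]→L[ℝ] ℝ) X =
        (𝓕.dHilbertForm q : (Model n × Model n) [⋀^Fin 2]→L[ℝ] ℝ) X := by
    subst hq
    rfl
  refine (hcongr _ (vectorOfCoords_coordsOfVector hφ hpφ) _).trans ?_
  refine congrArg (𝓕.dHilbertForm (vectorOfCoords φ (coordsOfVector φ p)) :
    (Model n × Model n) [⋀^Fin 2]→L[ℝ] ℝ) ?_
  funext i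
  fin_cases i <;> rfl

/-! ### The spray as a Hamiltonian vector field. -/

theorem geodesicSprayIn_eq (p : TangentBundle (𝓡 n) M) :
    geodesicSprayIn 𝓕.L φ p =
      mfderiv 𝓘(ℝ, Model n × Model n) (𝓡 n).tangent (vectorOfCoords φ) (coordsOfVector φ p)
        (localSpray 𝓕.L φ (coordsOfVector φ p)) := by
  let A : Model n × Model n →L[ℝ] Model n × Model n :=
    mfderiv 𝓘(ℝ, Model n × Model n) (𝓡 n).tangent
      (vectorOfCoords φ : Model n × Model n → TangentBundle (𝓡 n) M) (coordsOfVector φ p)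
  change ∑ i, (coordsOfVector φ p).2 i • A (stdVec i, 0) -
    ∑ i, (2 * sprayCoeff 𝓕.L φ (coordsOfVector φ p) i) • A (0, stdVec i) =
      A (localSpray 𝓕.L φ (coordsOfVector φ p))
  rw [localSpray, sum_smul_stdVec_prod, map_add, map_sum, map_sum]
  have he (i : Fin n) : (-(2 : ℝ) • sprayVector 𝓕.L φ (coordsOfVector φ p)) i =
      -(2 * sprayCoeff 𝓕.L φ (coordsOfVector φ p) i) := by
    simp [sprayVector_apply]
  simp only [map_smul, he]
  simp only [neg_smul, Finset.sum_neg_distrib, sub_eq_add_neg]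

/-- The chart `φ` is arbitrary while the `2`-form is the global one; comparing two charts is what
makes the spray intrinsic. -/
theorem dHilbertForm_geodesicSprayIn (hφ : φ ∈ IsManifold.maximalAtlas (𝓡 n) ∞ M)
    {p : TangentBundle (𝓡 n) M} (hp : p ∈ 𝓕.domain) (hpφ : p.1 ∈ φ.source)
    (w : TangentSpace (𝓡 n).tangent p) :
    𝓕.dHilbertForm p ![geodesicSprayIn 𝓕.L φ p, w] =
      mvfderiv (𝓡 n).tangent (energy 𝓕.L) p w := by
  have hz := coordsOfVector_mem hφ hp hpφ
  have h := dHilbertForm_apply hφ hp hpφ (localSpray 𝓕.L φ (coordsOfVector φ p))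
    (mfderiv (𝓡 n).tangent 𝓘(ℝ, Model n × Model n) (coordsOfVector φ) p w)
  rw [← geodesicSprayIn_eq, mfderiv_vectorOfCoords_comp hφ hpφ] at h
  refine (h.trans (extDeriv_localSpray (contDiffAt_localEnergy hφ hz)
    (eventually_fderiv_localEnergy_radial hφ hz) (det_metricMatrix_ne_zero hφ hz) _)).trans ?_
  have he : energy 𝓕.L =ᶠ[𝓝 p] localEnergy 𝓕.L φ ∘ coordsOfVector φ := by
    filter_upwards [isOpen_proj_preimage_source.mem_nhds hpφ] with q hq
    exact congrArg (energy 𝓕.L) (vectorOfCoords_coordsOfVector hφ hq).symm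
  have hc := mfderiv_comp p (I' := 𝓘(ℝ, Model n × Model n))
    ((contDiffAt_localEnergy hφ hz).differentiableAt (by simp)).mdifferentiableAt
    ((contMDiffAt_coordsOfVector hφ hpφ).mdifferentiableAt (by simp))
  rw [mfderiv_eq_fderiv] at hc
  exact (congrArg (fun A => A w) (he.mfderiv_eq.trans hc)).symm

theorem dHilbertForm_nondegenerate {p : TangentBundle (𝓡 n) M} (hp : p ∈ 𝓕.domain)
    (v : TangentSpace (𝓡 n).tangent p) (hv : ∀ w, 𝓕.dHilbertForm p ![v, w] = 0) : v = 0 := by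
  have hφ := IsManifold.chart_mem_maximalAtlas (I := 𝓡 n) (n := ∞) p.1
  have hpφ := mem_chart_source (Model n) p.1
  have hz := coordsOfVector_mem hφ hp hpφ
  have h0 : mfderiv (𝓡 n).tangent 𝓘(ℝ, Model n × Model n)
      (coordsOfVector (chartAt (Model n) p.1)) p v = (0 : Model n × Model n) := by
    refine eq_zero_of_extDeriv_localHilbertForm (contDiffAt_localEnergy hφ hz)
      (det_metricMatrix_ne_zero hφ hz) fun w => ?_
    refine (dHilbertForm_apply hφ hp hpφ _ w).symm.trans ?_
    rw [mfderiv_vectorOfCoords_comp hφ hpφ]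
    exact hv _
  rw [← mfderiv_vectorOfCoords_comp hφ hpφ v, h0]
  exact map_zero _

/-- The two expressions have the same contraction with `dη`, namely `dF`, so non-degeneracy
annihilates their difference. -/
theorem geodesicSpray_eq (hφ : φ ∈ IsManifold.maximalAtlas (𝓡 n) ∞ M)
    {p : TangentBundle (𝓡 n) M} (hp : p ∈ 𝓕.domain) (hpφ : p.1 ∈ φ.source) :
    𝓕.geodesicSpray p = geodesicSprayIn 𝓕.L φ p := by
  refine sub_eq_zero.1 (dHilbertForm_nondegenerate hp _ fun w => ?_)
  have h1 := dHilbertForm_geodesicSprayIn (𝓕 := 𝓕)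
    (IsManifold.chart_mem_maximalAtlas p.1) hp (mem_chart_source (Model n) p.1) w
  have h2 := dHilbertForm_geodesicSprayIn hφ hp hpφ w
  rw [map_vecCons_sub]
  exact sub_eq_zero.2 (h1.trans h2.symm)

/-- By `geodesicSpray_eq` one fixed chart describes the spray at all points near `p`. There it is
the tangent map of `vectorOfCoords φ` applied to the smooth field `localSpray`. -/
theorem contMDiffOn_geodesicSpray :
    ContMDiffOn (𝓡 n).tangent (𝓡 n).tangent.tangent ∞
      (fun q => (⟨q, 𝓕.geodesicSpray q⟩ : TangentBundle (𝓡 n).tangent (TangentBundle (𝓡 n) M)))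
      𝓕.domain := by
  intro p hp
  have hφ := IsManifold.chart_mem_maximalAtlas (I := 𝓡 n) (n := ∞) p.1
  have hpφ := mem_chart_source (Model n) p.1
  set φ := chartAt (Model n) p.1
  have hz := coordsOfVector_mem hφ hp hpφ
  have hopen : IsOpen ((fun z : Model n × Model n => z.1) ⁻¹' φ.target) :=
    φ.open_target.preimage continuous_fst
  have hΨ : ContMDiffOn 𝓘(ℝ, Model n × Model n) (𝓡 n).tangent ∞
      (vectorOfCoords φ : Model n × Model n → TangentBundle (𝓡 n) M)
      ((fun z : Model n × Model n => z.1) ⁻¹' φ.target) := fun z hz =>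
    (contMDiffAt_vectorOfCoords hφ hz).contMDiffWithinAt
  have hT := hΨ.contMDiffOn_tangentMapWithin (m := ∞) (by simp) hopen.uniqueMDiffOn
  have hTp := hT.contMDiffAt
    (x := (⟨coordsOfVector φ p, localSpray 𝓕.L φ (coordsOfVector φ p)⟩ :
      TangentBundle 𝓘(ℝ, Model n × Model n) (Model n × Model n)))
    ((hopen.preimage (FiberBundle.continuous_proj _ _)).mem_nhds hz.1)
  have hS : ContMDiffAt 𝓘(ℝ, Model n × Model n) 𝓘(ℝ, Model n × Model n).tangent ∞
      (fun z => (⟨z, localSpray 𝓕.L φ z⟩ :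
        TangentBundle 𝓘(ℝ, Model n × Model n) (Model n × Model n))) (coordsOfVector φ p) :=
    contMDiffAt_vectorSpace_iff_contDiffAt.2
      (contDiffAt_localSpray (contDiffAt_localEnergy hφ hz) (det_metricMatrix_ne_zero hφ hz))
  have hC := hTp.comp p (hS.comp p (contMDiffAt_coordsOfVector hφ hpφ))
  refine (hC.congr_of_eventuallyEq ?_).contMDiffWithinAt
  filter_upwards [isOpen_proj_preimage_source.mem_nhds hpφ, 𝓕.isOpen_domain.mem_nhds hp]
    with q hqφ hq
  have hcongr (q' : TangentBundle (𝓡 n) M) (hq' : q' = q) (X : Model n × Model n) :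
      (⟨q, X⟩ : TangentBundle (𝓡 n).tangent (TangentBundle (𝓡 n) M)) = ⟨q', X⟩ := by
    subst hq'
    rfl
  rw [geodesicSpray_eq hφ hq hqφ, geodesicSprayIn_eq]
  simp only [Function.comp, tangentMapWithin]
  rw [mfderivWithin_of_isOpen hopen (φ.map_source hqφ)]
  exact hcongr _ (vectorOfCoords_coordsOfVector hφ hqφ) _

theorem dHilbertForm_geodesicSpray {p : TangentBundle (𝓡 n) M} (hp : p ∈ 𝓕.domain)
    (w : TangentSpace (𝓡 n).tangent p) :
    𝓕.dHilbertForm p ![𝓕.geodesicSpray p, w] = mvfderiv (𝓡 n).tangent (energy 𝓕.L) p w :=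
  dHilbertForm_geodesicSprayIn (IsManifold.chart_mem_maximalAtlas p.1) hp
    (mem_chart_source (Model n) p.1) w

theorem isSymplecticOn_dHilbertForm :
    IsSymplecticOn (𝓡 n).tangent 𝓕.dHilbertForm 𝓕.domain where
  smooth := isSmoothFormOn_hilbertAlternating.extDerivForm 𝓕.isOpen_domain
  closed _ hp := extDerivForm_extDerivForm 𝓕.isOpen_domain isSmoothFormOn_hilbertAlternating hp
  nondegenerate _ hp := dHilbertForm_nondegenerate hp

theorem mvfderiv_energy {p : TangentBundle (𝓡 n) M} (hp : p ∈ 𝓕.domain)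
    (w : TangentSpace (𝓡 n).tangent p) :
    mvfderiv (𝓡 n).tangent (energy 𝓕.L) p w = 𝓕.L p * mvfderiv (𝓡 n).tangent 𝓕.L p w := by
  have hd : HasDerivAt (fun t : ℝ => 1 / 2 * t ^ 2) (𝓕.L p) (𝓕.L p) := by
    refine ((hasDerivAt_pow 2 (𝓕.L p)).const_mul (1 / 2)).congr_deriv ?_
    push_cast
    ring
  have hc := mfderiv_comp p (I' := 𝓘(ℝ, ℝ)) (I'' := 𝓘(ℝ, ℝ)) (g := fun t : ℝ => 1 / 2 * t ^ 2)
    hd.differentiableAt.mdifferentiableAt ((contMDiffAt_L hp).mdifferentiableAt (by simp))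
  rw [mfderiv_eq_fderiv, hd.hasFDerivAt.fderiv] at hc
  refine (congrArg (fun A => A w) hc).trans ?_
  change mvfderiv (𝓡 n).tangent 𝓕.L p w * 𝓕.L p = _
  exact mul_comm _ _

theorem isHamiltonianVectorFieldOn_energy :
    IsHamiltonianVectorFieldOn (𝓡 n).tangent 𝓕.dHilbertForm 𝓕.domain
      (energy 𝓕.L) 𝓕.geodesicSpray where
  smooth := contMDiffOn_geodesicSpray
  contraction _ hp := dHilbertForm_geodesicSpray hp

/-- Since `d(L²/2) = L dL` and `L > 0`, dividing the spray by `L` divides its contraction by `L`. -/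
theorem isHamiltonianVectorFieldOn_L :
    IsHamiltonianVectorFieldOn (𝓡 n).tangent 𝓕.dHilbertForm 𝓕.domain
      𝓕.L (fun p => (𝓕.L p)⁻¹ • 𝓕.geodesicSpray p) where
  smooth := by
    have h : ContMDiffOn (𝓡 n).tangent 𝓘(ℝ, ℝ) ∞ (fun p => (𝓕.L p)⁻¹) 𝓕.domain :=
      fun p hp => ((contDiffAt_inv ℝ (𝓕.pos p hp).ne').contMDiffAt.comp p
        (contMDiffAt_L hp)).contMDiffWithinAt
    exact h.smul_section contMDiffOn_geodesicSpray
  contraction p hp w := by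
    rw [map_vecCons_smul, dHilbertForm_geodesicSpray hp, mvfderiv_energy hp,
      inv_mul_cancel_left₀ (𝓕.pos p hp).ne']

end FinslerMetric

end Finsler

end

theorem mainTheorem11 (n : ℕ) (M : Type*) [TopologicalSpace M]
    [ChartedSpace (Finsler.Model n) M] [IsManifold (𝓡 n) ∞ M] (𝓕 : Finsler.FinslerMetric n M) :
    -- the expressions of the Hilbert form and of the spray are the same in all charts
    (∀ φ ∈ IsManifold.maximalAtlas (𝓡 n) ∞ M, ∀ p ∈ 𝓕.domain, p.1 ∈ φ.source →
      𝓕.hilbertForm p = Finsler.hilbertFormIn 𝓕.L φ p ∧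
      𝓕.geodesicSpray p = Finsler.geodesicSprayIn 𝓕.L φ p) ∧
    -- `dη(𝔾, ·) = d(L² / 2)`
    (∀ p ∈ 𝓕.domain, ∀ w : TangentSpace (𝓡 n).tangent p,
      𝓕.dHilbertForm p ![𝓕.geodesicSpray p, w] =
        mvfderiv (𝓡 n).tangent (Finsler.energy 𝓕.L) p w) ∧
    -- `dη` is a symplectic form, and `𝔾` and `𝔾 / L` are the Hamiltonian fields of `L² / 2` and `L`
    Finsler.IsSymplecticOn (𝓡 n).tangent 𝓕.dHilbertForm 𝓕.domain ∧
    Finsler.IsHamiltonianVectorFieldOn (𝓡 n).tangent 𝓕.dHilbertForm 𝓕.domain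
      (Finsler.energy 𝓕.L) 𝓕.geodesicSpray ∧
    Finsler.IsHamiltonianVectorFieldOn (𝓡 n).tangent 𝓕.dHilbertForm 𝓕.domain
      𝓕.L (fun p => (𝓕.L p)⁻¹ • 𝓕.geodesicSpray p) := by
  exact ⟨fun φ hφ p hp hpφ => ⟨Finsler.FinslerMetric.hilbertForm_eq hφ hp hpφ,
      Finsler.FinslerMetric.geodesicSpray_eq hφ hp hpφ⟩,
    fun p hp w => Finsler.FinslerMetric.dHilbertForm_geodesicSpray hp w,
    Finsler.FinslerMetric.isSymplecticOn_dHilbertForm,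
    Finsler.FinslerMetric.isHamiltonianVectorFieldOn_energy,
    Finsler.FinslerMetric.isHamiltonianVectorFieldOn_L⟩
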